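/- An ultrametric Polish space is a nonempty separable complete metric space $(U,d)$ with $d(x,z)\le\max\{d(x,y),d(y,z)\}$ for all $x,y,z\in U$. Let $\mathbb U$ be the Urysohn space and let $F(\mathbb U)$ be the set of its nonempty closed subsets, with the Effros Borel structure (generated by the sets $\{F : F\cap V\neq\emptyset\}$, $V\subseteq\mathbb U$ open). Polish metric spaces are identified, up to isometry, with the elements of $F(\mathbb U)$ with the induced metric, and every class of Polish metric spaces below is regarded as a subset of $F(\mathbb U)$ with the inherited Borel structure. For binary relations $R$ on $X$ and $S$ on $Y$, where $X$ and $Y$ carry Borel structures, $R$ is Borel reducible to $S$ if there is a Borel map $f:X\to Y$ such that $x\mathrel R x'\iff f(x)\mathrel S f(x')$ for all $x,x'\in X$; $R$ and $S$ are Borel bireducible if each is Borel reducible to the other. Graph isomorphism is the isomorphism relation on the Polish space of (simple, undirected) graphs with vertex set $\mathbb N$. Then each of the following relations is Borel bireducible with graph isomorphism: 1. isometry on discrete ultrametric Polish spaces (those whose topology is discrete); 2. isometry on locally compact ultrametric Polish spaces; 3. isometry on the ultrametric Polish spaces all of whose distances belong to $D=\{0\}\cup\{1+2^{-n} : n\in\mathbb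 N\}$. -/

import Mathlib

/-! ### Borel reducibility -/

/-- `R ≤_B S`: there is a Borel map `f` with `R x x' ↔ S (f x) (f x')`. -/
def BorelReducible {X Y : Type*} [MeasurableSpace X] [MeasurableSpace Y]
    (R : X → X → Prop) (S : Y → Y → Prop) : Prop :=
  ∃ f : X → Y, Measurable f ∧ ∀ x x' : X, R x x' ↔ S (f x) (f x')

/-- `R ∼_B S`: each of the two relations is Borel reducible to the other. -/
def BorelBireducible {X Y : Type*} [MeasurableSpace X] [MeasurableSpace Y]
    (R : X → X → Prop) (S : Y → Y → Prop) : Prop :=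
  BorelReducible R S ∧ BorelReducible S R

/-! ### Countable graphs -/

/-- Isomorphism of graphs with vertex set `ℕ`. The type `SimpleGraph ℕ` carries the Borel structure
induced by the adjacency relation from the product `ℕ → ℕ → Prop` of discrete spaces. -/
def GraphIso (G H : SimpleGraph ℕ) : Prop := Nonempty (G ≃g H)

/-! ### The Urysohn space

It is the completion of a countable pseudometric space with underlying set `ℕ`, whose distance is
built by adding one point at a time: the point `n` realizes (up to the largest `1`-Lipschitz
extension) the `n`-th prescribed list of rational distances to an initial segment of the points
added before, whenever these distances are compatible with the triangle inequality
`d j k ≤ g j + g k`. That the completion is the Urysohn space is `UrysohnSpace.isUrysohn`. -/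

/-- A metric space is Urysohn if it is complete, separable, nonempty, and every Katetov function
on a finite subset is realized by a point. Up to isometry there is exactly one such space. -/
structure IsUrysohn (X : Type*) [MetricSpace X] : Prop where
  nonempty : Nonempty X
  complete : CompleteSpace X
  separable : TopologicalSpace.SeparableSpace X
  extension : ∀ (A : Finset X) (f : X → ℝ),
    (∀ a ∈ A, ∀ b ∈ A, |f a - f b| ≤ dist a b ∧ dist a b ≤ f a + f b) →
      ∃ x : X, ∀ a ∈ A, dist x a = f a

namespace UrysohnConstruction

/-- Every list of rationals is `code n` for infinitely many `n`. -/
def code (n : ℕ) : List ℚ := ((Encodable.decode n.unpair.1 : Option (List ℚ))).getD []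

/-- The prescribed distances `g` respect the triangle inequality `d j k ≤ g j + g k`. -/
def Admissible (d : ℕ → ℕ → ℝ) (n : ℕ) (g : List ℚ) : Prop :=
  0 < g.length ∧ g.length ≤ n ∧
    ∀ j k : Fin g.length, d j k ≤ (g.get j : ℝ) + (g.get k : ℝ)

open Classical in
/-- The distances from the new point `n` to the points `i < n`. -/
noncomputable def row (d : ℕ → ℕ → ℝ) (n i : ℕ) : ℝ :=
  if Admissible d n (code n) then
    ⨅ j : Fin (code n).length, (((code n).get j : ℝ) + d j i)
  else d 0 i

/-- The distance on the first `n` points. -/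
noncomputable def stage : ℕ → ℕ → ℕ → ℝ
  | 0, _, _ => 0
  | n + 1, i, j =>
    if i = n then (if j = n then 0 else row (stage n) n j)
    else if j = n then row (stage n) n i else stage n i j

/-- The distance on `ℕ`. -/
noncomputable def preDist (i j : ℕ) : ℝ := stage (max i j + 1) i j

theorem row_lip {d : ℕ → ℕ → ℝ} {n : ℕ} (h3 : ∀ i < n, ∀ j < n, ∀ k < n, d i k ≤ d i j + d j k)
    {i j : ℕ} (hi : i < n) (hj : j < n) : row d n i ≤ row d n j + d j i := by
  unfold row
  split_ifs with h
  · obtain ⟨h0, hn, -⟩ := h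
    have : Nonempty (Fin (code n).length) := ⟨⟨0, h0⟩⟩
    obtain ⟨m, hm⟩ := exists_eq_ciInf_of_finite
      (f := fun m : Fin (code n).length => (((code n).get m : ℝ) + d m j))
    rw [← hm]
    refine (ciInf_le (Set.finite_range _).bddBelow m).trans ?_
    have := h3 m (m.2.trans_le hn) j hj i hi
    linarith
  · exact h3 0 (by omega) j hj i hi

theorem le_row_add {d : ℕ → ℕ → ℝ} {n : ℕ} (h2 : ∀ i j, d i j = d j i)
    (h3 : ∀ i < n, ∀ j < n, ∀ k < n, d i k ≤ d i j + d j k)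
    {i j : ℕ} (hi : i < n) (hj : j < n) : d i j ≤ row d n i + row d n j := by
  unfold row
  split_ifs with h
  · obtain ⟨h0, hn, h⟩ := h
    have : Nonempty (Fin (code n).length) := ⟨⟨0, h0⟩⟩
    obtain ⟨m, hm⟩ := exists_eq_ciInf_of_finite
      (f := fun m : Fin (code n).length => (((code n).get m : ℝ) + d m i))
    obtain ⟨l, hl⟩ := exists_eq_ciInf_of_finite
      (f := fun m : Fin (code n).length => (((code n).get m : ℝ) + d m j))
    rw [← hm, ← hl]
    have h4 := h3 i hi m (m.2.trans_le hn) j hj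
    have h5 := h3 m (m.2.trans_le hn) l (l.2.trans_le hn) j hj
    have h6 := h m l
    have h7 := h2 i m
    linarith
  · have := h3 i hi 0 (by omega) j hj
    have := h2 i 0
    linarith

theorem stage_self : ∀ n i, stage n i i = 0
  | 0, _ => rfl
  | n + 1, i => by
    unfold stage
    split_ifs
    · rfl
    · exact stage_self n i

theorem stage_comm : ∀ n i j, stage n i j = stage n j i
  | 0, _, _ => rfl
  | n + 1, i, j => by
    unfold stage
    split_ifs
    · rfl
    · rfl
    · rfl
    · exact stage_comm n i j

theorem stage_triangle : ∀ n, ∀ i < n, ∀ j < n, ∀ k < n,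
    stage n i k ≤ stage n i j + stage n j k
  | 0 => by simp
  | n + 1 => by
    intro i hi j hj k hk
    have h3 := stage_triangle n
    have h2 := stage_comm n
    have key1 : ∀ a, a < n → ∀ b, b < n → row (stage n) n a ≤ row (stage n) n b + stage n b a :=
      fun a ha b hb => row_lip h3 ha hb
    have key2 : ∀ a, a < n → ∀ b, b < n → stage n a b ≤ row (stage n) n a + row (stage n) n b :=
      fun a ha b hb => le_row_add h2 h3 ha hb
    have nn : ∀ a, a < n → 0 ≤ row (stage n) n a := fun a ha => by
      have := key2 a ha a ha
      rw [stage_self] at this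
      linarith
    unfold stage
    split_ifs with h1 h4 h5 h5 h4 h5 h5
    · simp
    · have := nn j (by omega); linarith
    · simp
    · exact key1 k (by omega) j (by omega)
    · simp
    · have := key1 i (by omega) j (by omega)
      rw [h2 i j]; linarith
    · exact key2 i (by omega) k (by omega)
    · exact h3 i (by omega) j (by omega) k (by omega)

theorem stage_eq {n i j : ℕ} (h : max i j < n) : stage n i j = preDist i j := by
  induction n with
  | zero => omega
  | succ n ih =>
    by_cases hn : max i j = n
    · rw [preDist, hn]
    · rw [← ih (by omega)]
      conv_lhs => unfold stage
      rw [if_neg (by omega), if_neg (by omega)]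

theorem preDist_comm (i j : ℕ) : preDist i j = preDist j i := by
  unfold preDist
  rw [max_comm j i, stage_comm]

theorem preDist_triangle (i j k : ℕ) : preDist i k ≤ preDist i j + preDist j k := by
  have := stage_triangle (max (max i j) k + 1) i (by omega) j (by omega) k (by omega)
  rwa [stage_eq (by omega), stage_eq (by omega), stage_eq (by omega)] at this

end UrysohnConstruction

/-- The countable pseudometric space whose completion is the Urysohn space. -/
def UrysohnPre : Type := ℕ

open UrysohnConstruction in
noncomputable instance : PseudoMetricSpace UrysohnPre where
  dist i j := preDist i j
  dist_self _ := stage_self _ _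
  dist_comm i j := preDist_comm i j
  dist_triangle i j k := preDist_triangle i j k

/-- The Urysohn space. -/
def UrysohnSpace : Type := UniformSpace.Completion UrysohnPre

noncomputable instance : MetricSpace UrysohnSpace :=
  inferInstanceAs (MetricSpace (UniformSpace.Completion UrysohnPre))

instance : CompleteSpace UrysohnSpace :=
  inferInstanceAs (CompleteSpace (UniformSpace.Completion UrysohnPre))

namespace UrysohnSpace

/-- The canonical dense sequence. -/
noncomputable def pt (n : ℕ) : UrysohnSpace := ((show UrysohnPre from n : UrysohnPre) : UniformSpace.Completion UrysohnPre)

theorem dist_pt (i j : ℕ) : dist (pt i) (pt j) = UrysohnConstruction.preDist i j :=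
  UniformSpace.Completion.dist_eq _ _

theorem denseRange_pt : DenseRange pt :=
  UniformSpace.Completion.denseRange_coe (α := UrysohnPre)

instance : TopologicalSpace.SeparableSpace UrysohnSpace :=
  .of_denseRange pt denseRange_pt

theorem code_surj (g : List ℚ) (N : ℕ) : ∃ n, N ≤ n ∧ UrysohnConstruction.code n = g := by
  refine ⟨Nat.pair (Encodable.encode g) N, Nat.right_le_pair _ _, ?_⟩
  simp [UrysohnConstruction.code]

open UrysohnConstruction in
/-- Distances to an initial segment of the dense sequence are realized up to extension. -/
theorem exists_pt (k : ℕ) (hk : 0 < k) (g : ℕ → ℚ)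
    (hg : ∀ i < k, ∀ j < k, dist (pt i) (pt j) ≤ g i + g j) :
    ∃ x : UrysohnSpace, ∀ i < k, dist x (pt i) ≤ g i ∧
      ∃ j < k, g j + dist (pt j) (pt i) ≤ dist x (pt i) := by
  obtain ⟨n, hkn, hn⟩ := code_surj ((List.range k).map g) k
  have hlen : (code n).length = k := by simp [hn]
  have hget : ∀ j : Fin (code n).length, (code n).get j = g j := by
    intro j; simp [hn]
  have hst : ∀ i < k, ∀ j < k, stage n i j = dist (pt i) (pt j) := by
    intro i hi j hj
    rw [dist_pt, stage_eq (by omega)]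
  have hadm : Admissible (stage n) n (code n) := by
    refine ⟨by omega, by omega, fun i j => ?_⟩
    rw [hget, hget, hst i (by omega) j (by omega)]
    exact hg i (by omega) j (by omega)
  have hd : ∀ i < k, dist (pt n) (pt i) =
      ⨅ j : Fin (code n).length, ((g j : ℝ) + dist (pt j) (pt i)) := by
    intro i hi
    rw [dist_pt, preDist, max_eq_left (by omega)]
    unfold stage
    rw [if_pos rfl, if_neg (by omega), row, if_pos hadm]
    refine iInf_congr fun j => ?_
    rw [hget, hst j (by omega) i hi]
  refine ⟨pt n, fun i hi => ⟨?_, ?_⟩⟩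
  · rw [hd i hi]
    refine (ciInf_le (Set.finite_range _).bddBelow (⟨i, by omega⟩ : Fin (code n).length)).trans ?_
    simp
  · rw [hd i hi]
    have : Nonempty (Fin (code n).length) := ⟨⟨0, by omega⟩⟩
    obtain ⟨m, hm⟩ := exists_eq_ciInf_of_finite
      (f := fun m : Fin (code n).length => ((g m : ℝ) + dist (pt m) (pt i)))
    exact ⟨m, by omega, hm.le⟩

/-- Approximate realization of prescribed distances to finitely many points. -/
theorem exists_approx {ι : Type} [Fintype ι] [Nonempty ι] (a : ι → UrysohnSpace) (f : ι → ℝ)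
    (hf : ∀ s t, dist (a s) (a t) ≤ f s + f t) {ε : ℝ} (hε : 0 < ε) :
    ∃ x : UrysohnSpace, ∀ s, dist x (a s) ≤ f s + ε ∧
      ∃ t, f t + dist (a t) (a s) ≤ dist x (a s) + ε := by
  have hp : ∀ s, ∃ n, dist (a s) (pt n) < ε / 4 := fun s => by
    obtain ⟨n, hn⟩ := denseRange_pt.exists_dist_lt (a s) (show 0 < ε / 4 by positivity)
    exact ⟨n, hn⟩
  choose p hp using hp
  -- the largest extension of `f`
  let F : ℕ → ℝ := fun i => ⨅ t, (f t + dist (a t) (pt i))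
  have hF1 : ∀ i t, F i ≤ f t + dist (a t) (pt i) := fun i t =>
    ciInf_le (Set.finite_range _).bddBelow t
  have hF2 : ∀ i, ∃ t, f t + dist (a t) (pt i) = F i := fun i =>
    exists_eq_ciInf_of_finite
  have hq : ∀ i, ∃ q : ℚ, F i < q ∧ (q : ℝ) < F i + ε / 4 := fun i =>
    exists_rat_btwn (by linarith)
  choose g hg1 hg2 using hq
  obtain ⟨k, hk⟩ : ∃ k, ∀ s, p s < k := by
    obtain ⟨k, hk⟩ := (Set.finite_range p).bddAbove
    exact ⟨k + 1, fun s => Nat.lt_succ_of_le (hk ⟨s, rfl⟩)⟩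
  have hk0 : 0 < k := (Nat.zero_le _).trans_lt (hk (Classical.arbitrary ι))
  obtain ⟨x, hx⟩ := exists_pt k hk0 g (by
    intro i _ j _
    obtain ⟨s, hs⟩ := hF2 i
    obtain ⟨t, ht⟩ := hF2 j
    have h1 := hf s t
    have h2 := dist_triangle4 (pt i) (a s) (a t) (pt j)
    have h3 := dist_comm (pt i) (a s)
    have := hg1 i
    have := hg1 j
    linarith)
  refine ⟨x, fun s => ⟨?_, ?_⟩⟩
  · have h1 := (hx (p s) (hk s)).1
    have h2 := hF1 (p s) s
    have h3 := hg2 (p s)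
    have h4 := hp s
    have h5 := dist_triangle x (pt (p s)) (a s)
    have h6 := dist_comm (pt (p s)) (a s)
    linarith
  · obtain ⟨j, -, hj⟩ := (hx (p s) (hk s)).2
    obtain ⟨t, ht⟩ := hF2 j
    refine ⟨t, ?_⟩
    have h1 := hg1 j
    have h2 := dist_triangle4 (a t) (pt j) (pt (p s)) (a s)
    have h3 := dist_triangle x (a s) (pt (p s))
    have h4 := hp s
    have h6 := dist_comm (pt (p s)) (a s)
    linarith

theorem exists_exact {ι : Type} [Fintype ι] [Nonempty ι] (a : ι → UrysohnSpace) (f : ι → ℝ)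
    (h1 : ∀ s t, f s - f t ≤ dist (a s) (a t)) (h2 : ∀ s t, dist (a s) (a t) ≤ f s + f t) :
    ∃ x : UrysohnSpace, ∀ s, dist x (a s) = f s := by
  -- one step of the approximation
  have step : ∀ (ε : ℝ) (x : UrysohnSpace), ∃ y : UrysohnSpace,
      0 < ε → (∀ s, |dist x (a s) - f s| ≤ ε) → (∀ s, |dist y (a s) - f s| ≤ ε / 2) ∧ dist x y ≤ 2 * ε := by
    intro ε x
    by_cases hε : 0 < ε
    swap
    · exact ⟨x, fun h => absurd h hε⟩
    by_cases hx : ∀ s, |dist x (a s) - f s| ≤ ε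
    swap
    · exact ⟨x, fun _ h => absurd h hx⟩
    have hx1 : ∀ s, dist x (a s) ≤ f s + ε := fun s => by linarith [(abs_le.1 (hx s)).2]
    have hx2 : ∀ s, f s ≤ dist x (a s) + ε := fun s => by linarith [(abs_le.1 (hx s)).1]
    let a' : Option ι → UrysohnSpace := fun o => o.elim x a
    let f' : Option ι → ℝ := fun o => o.elim ε f
    obtain ⟨y, hy⟩ := exists_approx a' f' (by
      rintro (_ | s) (_ | t)
      · simp [a', f', hε.le]
      · have := hx1 t
        simp only [a', f', Option.elim]
        linarith
      · have := hx1 s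
        simp only [a', f', Option.elim]
        rw [dist_comm]
        linarith
      · exact h2 s t) (show 0 < ε / 2 by positivity)
    refine ⟨y, fun _ _ => ⟨fun s => abs_le.2 ⟨?_, ?_⟩, ?_⟩⟩
    · obtain ⟨t, ht⟩ := (hy (some s)).2
      rcases t with _ | t
      · simp only [a', f', Option.elim] at ht
        linarith [hx2 s]
      · simp only [a', f', Option.elim] at ht
        have := h1 s t
        rw [dist_comm] at this
        linarith
    · have := (hy (some s)).1
      simp only [a', f', Option.elim] at this
      linarith
    · have := (hy none).1
      simp only [a', f', Option.elim] at this
      rw [dist_comm]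
      linarith
  obtain ⟨x0, hx0⟩ : ∃ x0 : UrysohnSpace, ∀ s, |dist x0 (a s) - f s| ≤ 1 := by
    obtain ⟨x, hx⟩ := exists_approx a f h2 (show (0 : ℝ) < 1 by norm_num)
    refine ⟨x, fun s => abs_le.2 ⟨?_, by linarith [(hx s).1]⟩⟩
    obtain ⟨t, ht⟩ := (hx s).2
    have := h1 s t
    rw [dist_comm] at this
    linarith
  choose nxt hn using step
  let u : ℕ → UrysohnSpace := fun n => Nat.rec x0 (fun n y => nxt ((1 / 2) ^ n) y) n
  have hu : ∀ n, ∀ s, |dist (u n) (a s) - f s| ≤ (1 / 2) ^ n := by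
    intro n
    induction n with
    | zero =>
      intro s
      rw [pow_zero]
      exact hx0 s
    | succ n ih =>
      have := (hn ((1 / 2) ^ n) (u n) (by positivity) ih).1
      intro s
      refine (this s).trans (le_of_eq ?_)
      rw [pow_succ]; ring
  have hc : CauchySeq u := by
    refine cauchySeq_of_le_geometric (1 / 2) 2 (by norm_num) fun n => ?_
    exact (hn ((1 / 2) ^ n) (u n) (by positivity) (hu n)).2
  obtain ⟨x, hx⟩ := cauchySeq_tendsto_of_complete hc
  refine ⟨x, fun s => ?_⟩
  have ht : Filter.Tendsto (fun n => |dist (u n) (a s) - f s|) Filter.atTop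
      (nhds |dist x (a s) - f s|) :=
    ((hx.dist tendsto_const_nhds).sub tendsto_const_nhds).abs
  have h0 : |dist x (a s) - f s| ≤ 0 :=
    le_of_tendsto_of_tendsto' ht
      (tendsto_pow_atTop_nhds_zero_of_lt_one (r := (1 / 2 : ℝ)) (by norm_num) (by norm_num))
      fun n => hu n s
  have := abs_nonpos_iff.1 h0
  linarith

/-- `UrysohnSpace` is the Urysohn space. -/
theorem isUrysohn : IsUrysohn UrysohnSpace where
  nonempty := ⟨pt 0⟩
  complete := inferInstance
  separable := inferInstance
  extension := by
    intro A f hf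
    rcases A.eq_empty_or_nonempty with rfl | hA
    · exact ⟨pt 0, by simp⟩
    have : Nonempty A := hA.to_subtype
    obtain ⟨x, hx⟩ := exists_exact (ι := A) (fun s => s.1) (fun s => f s.1)
      (fun s t => (le_abs_self _).trans (hf s.1 s.2 t.1 t.2).1)
      (fun s t => (hf s.1 s.2 t.1 t.2).2)
    exact ⟨x, fun a ha => hx ⟨a, ha⟩⟩

end UrysohnSpace

/-! ### Polish metric spaces as closed subsets of the Urysohn space -/

/-- `F(X)`: the nonempty closed subsets of `X`. -/
def NonemptyClosed (X : Type*) [TopologicalSpace X] : Type _ :=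
  {F : Set X // IsClosed F ∧ F.Nonempty}

/-- The Effros Borel structure on `F(X)`, generated by the sets `{F | F ∩ U ≠ ∅}`, `U` open. -/
instance effrosMeasurableSpace (X : Type*) [TopologicalSpace X] :
    MeasurableSpace (NonemptyClosed X) :=
  MeasurableSpace.generateFrom
    {S | ∃ U : Set X, IsOpen U ∧ S = {F : NonemptyClosed X | (F.1 ∩ U).Nonempty}}

/-- Isometry (by a surjective isometric map) between closed subsets of the Urysohn space, with
the induced metrics. -/
def Isometric (F G : NonemptyClosed UrysohnSpace) : Prop := Nonempty (F.1 ≃ᵢ G.1)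

/-- The discrete ultrametric Polish spaces. -/
def DiscreteUltrametricPolish : Type :=
  {F : NonemptyClosed UrysohnSpace // IsUltrametricDist F.1 ∧ DiscreteTopology F.1}

/-- The locally compact ultrametric Polish spaces. -/
def LocallyCompactUltrametricPolish : Type :=
  {F : NonemptyClosed UrysohnSpace // IsUltrametricDist F.1 ∧ LocallyCompactSpace F.1}

/-- `U_D`: the ultrametric Polish spaces all of whose distances belong to `D`. -/
def UltrametricPolishWithDistances (D : Set ℝ) : Type :=
  {F : NonemptyClosed UrysohnSpace //
    IsUltrametricDist F.1 ∧ ∀ x y : F.1, dist x y ∈ D}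

/-! Each class carries the Borel structure inherited from `F(UrysohnSpace)`. -/

instance : MeasurableSpace DiscreteUltrametricPolish :=
  inferInstanceAs (MeasurableSpace {F : NonemptyClosed UrysohnSpace //
    IsUltrametricDist F.1 ∧ DiscreteTopology F.1})

instance : MeasurableSpace LocallyCompactUltrametricPolish :=
  inferInstanceAs (MeasurableSpace {F : NonemptyClosed UrysohnSpace //
    IsUltrametricDist F.1 ∧ LocallyCompactSpace F.1})

instance (D : Set ℝ) : MeasurableSpace (UltrametricPolishWithDistances D) :=
  inferInstanceAs (MeasurableSpace {F : NonemptyClosed UrysohnSpace //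
    IsUltrametricDist F.1 ∧ ∀ x y : F.1, dist x y ∈ D})

/-! ### Borel sets of closed sets -/

/-! Both directions are explicit codings.

From spaces to graphs: a complete ultrametric space is determined by its balls of rational radius,
together with their radii and the relation of meeting. Two balls that meet are nested, so a point is
a coherent family of balls, and completeness turns every such family back into a point
(`exists_ballRelated`). Each ball gets infinitely many names from a dense sequence of the ambient
space. The names become vertices of `ballGraph`, joined when their balls meet, and the radius index
is recorded by a number of leaves. Isomorphic graphs then mean isometric spaces
(`nonempty_ballGraph_iso_iff`). Adjacency is a Borel condition on the closed set, so this reduces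
isometry on every class of ultrametric Polish spaces to graph isomorphism.

From graphs to spaces: weight each finite sequence of vertices by a code of its atomic type. Any
isomorphism of the resulting weighted trees yields a graph isomorphism by back-and-forth
(`graphIso_of_treeIso`). The weighted tree is turned into an ultrametric space with distances `0`
and `1 + 2⁻ⁿ`: the length of a common prefix gives the distance, and the weight is the number of
points at a node (`exists_treeIso_of_treeDist_eq`). Distinct points are more than `1` apart, so one
space serves all three classes. Its points are placed in the Urysohn space one at a time, each
depending on a finite part of the graph, which makes the map Borel. -/

theorem NonemptyClosed.measurableSet_exists_prod_mem {M : Type*} [TopologicalSpace M]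
    [SecondCountableTopology M] {W : Set (M × M × M)} (hW : IsOpen W) :
    MeasurableSet {F : NonemptyClosed M | ∃ x ∈ F.1, ∃ y ∈ F.1, ∃ z ∈ F.1, (x, y, z) ∈ W} := by
  let B := TopologicalSpace.countableBasis M
  have hB : TopologicalSpace.IsTopologicalBasis B := TopologicalSpace.isBasis_countableBasis M
  have hm : ∀ U ∈ B, MeasurableSet {F : NonemptyClosed M | (F.1 ∩ U).Nonempty} := fun U hU =>
    MeasurableSpace.measurableSet_generateFrom ⟨U, hB.isOpen hU, rfl⟩
  -- An open set of triples is a union of basic boxes, and only countably many boxes exist, so the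
  -- condition is a countable union of finite intersections of generators.
  have h : {F : NonemptyClosed M | ∃ x ∈ F.1, ∃ y ∈ F.1, ∃ z ∈ F.1, (x, y, z) ∈ W} =
      ⋃ U ∈ B, ⋃ V ∈ B, ⋃ T ∈ B, ⋃ _ : U ×ˢ V ×ˢ T ⊆ W,
        ({F : NonemptyClosed M | (F.1 ∩ U).Nonempty} ∩ {F | (F.1 ∩ V).Nonempty}) ∩
          {F | (F.1 ∩ T).Nonempty} := by
    ext F
    simp only [Set.mem_ofPred_eq, Set.mem_iUnion, Set.mem_inter_iff, exists_prop]
    constructor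
    · rintro ⟨x, hx, y, hy, z, hz, hxyz⟩
      obtain ⟨_, ⟨U, hU, _, ⟨V, hV, T, hT, rfl⟩, rfl⟩, ⟨h1, h2, h3⟩, h⟩ :=
        (hB.prod (hB.prod hB)).exists_subset_of_mem_open hxyz hW
      exact ⟨U, hU, V, hV, T, hT, h, ⟨⟨x, hx, h1⟩, ⟨y, hy, h2⟩⟩, ⟨z, hz, h3⟩⟩
    · rintro ⟨U, hU, V, hV, T, hT, h, ⟨⟨x, hx, h1⟩, ⟨y, hy, h2⟩⟩, ⟨z, hz, h3⟩⟩
      exact ⟨x, hx, y, hy, z, hz, h ⟨h1, h2, h3⟩⟩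
  have hc : B.Countable := TopologicalSpace.countable_countableBasis M
  rw [h]
  exact .biUnion hc fun U hU => .biUnion hc fun V hV => .biUnion hc fun T hT => .iUnion fun _ =>
    ((hm U hU).inter (hm V hV)).inter (hm T hT)

/-! ### The balls of an ultrametric subspace -/

/-- An enumeration of the rational radii. -/
noncomputable def rationalRadius (i : ℕ) : ℝ := ((Encodable.decode i : Option ℚ).getD 0 : ℚ)

theorem exists_rationalRadius_eq (q : ℚ) : ∃ i, rationalRadius i = q :=
  ⟨Encodable.encode q, by rw [rationalRadius, Encodable.encodek, Option.getD_some]⟩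

section traceBall

variable {M : Type*} [MetricSpace M]

/-- The ball of `F` of radius `rationalRadius p.2.1` around any point of `F` that is close to
`u p.1`. The component `p.2.2` only provides infinitely many names for each ball. -/
def traceBall (u : ℕ → M) (F : Set M) (p : ℕ × ℕ × ℕ) : Set F :=
  {y | ∃ x : F, dist (x : M) (u p.1) < rationalRadius p.2.1 / 2 ∧
    dist x y < rationalRadius p.2.1}

variable {u : ℕ → M} {F F' : Set M}

/-- All admissible centres lie within one radius of each other, and in an ultrametric space every
point of a ball is its centre. A name therefore denotes a single ball or the empty set. -/
theorem traceBall_eq_ball [IsUltrametricDist F] {p : ℕ × ℕ × ℕ} {y : F}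
    (hy : y ∈ traceBall u F p) : traceBall u F p = Metric.ball y (rationalRadius p.2.1) := by
  obtain ⟨x, hx, hxy⟩ := hy
  ext z
  rw [Metric.mem_ball]
  constructor
  · rintro ⟨x', hx', hz⟩
    -- Here only the ordinary triangle inequality is available, since `u p.1` need not lie in `F`;
    -- this is the reason for the factor `1 / 2` in `traceBall`.
    have h1 : dist x x' < rationalRadius p.2.1 := by
      rw [Subtype.dist_eq]
      have := dist_triangle_right (x : M) x' (u p.1)
      linarith
    rw [dist_comm] at hz hxy
    have h2 := dist_triangle_max z x' x
    have h3 := dist_triangle_max z x y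
    rw [dist_comm x' x] at h2
    rw [dist_comm] at hz
    rw [dist_comm y x] at hxy
    rw [dist_comm x' z] at hz
    exact h3.trans_lt (max_lt (h2.trans_lt (max_lt hz h1)) hxy)
  · intro h
    refine ⟨x, hx, (dist_triangle_max x y z).trans_lt (max_lt hxy ?_)⟩
    rwa [dist_comm]

theorem rationalRadius_pos_of_mem {p : ℕ × ℕ × ℕ} {y : F} (hy : y ∈ traceBall u F p) :
    0 < rationalRadius p.2.1 :=
  dist_nonneg.trans_lt hy.choose_spec.2

theorem exists_mem_traceBall (hu : DenseRange u) (y : F) {i : ℕ} (hi : 0 < rationalRadius i) :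
    ∃ n, ∀ k, y ∈ traceBall u F (n, i, k) := by
  obtain ⟨n, hn⟩ := hu.exists_dist_lt (y : M) (half_pos hi)
  exact ⟨n, fun k => ⟨y, hn, by simpa using hi⟩⟩

/-- `σ` and its partial inverse `τ` transport the names of balls of `F` to names of balls of
`F'`. -/
structure IsBallEmbedding (u : ℕ → M) (F F' : Set M) (σ τ : ℕ × ℕ × ℕ → ℕ × ℕ × ℕ) :
    Prop where
  nonempty : ∀ p, (traceBall u F p).Nonempty → (traceBall u F' (σ p)).Nonempty
  radius : ∀ p, (traceBall u F p).Nonempty → (σ p).2.1 = p.2.1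
  inv : ∀ p, (traceBall u F p).Nonempty → τ (σ p) = p
  meet : ∀ p q, (traceBall u F p).Nonempty → (traceBall u F q).Nonempty →
    ((traceBall u F p ∩ traceBall u F q).Nonempty ↔
      (traceBall u F' (σ p) ∩ traceBall u F' (σ q)).Nonempty)

variable {σ τ : ℕ × ℕ × ℕ → ℕ × ℕ × ℕ}

/-- The points `x` and `y` lie in corresponding balls. -/
def BallRelated (u : ℕ → M) (F F' : Set M) (σ : ℕ × ℕ × ℕ → ℕ × ℕ × ℕ) (x : F) (y : F') :
    Prop :=
  ∀ p, x ∈ traceBall u F p → y ∈ traceBall u F' (σ p)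

/-- For any rational radius above `dist x x'`, one ball contains both points, and its counterpart,
of the same radius, contains `y` and `y'`. -/
theorem BallRelated.dist_le [IsUltrametricDist F] [IsUltrametricDist F'] (hu : DenseRange u)
    (h : IsBallEmbedding u F F' σ τ) {x x' : F} {y y' : F'} (hx : BallRelated u F F' σ x y)
    (hx' : BallRelated u F F' σ x' y') : dist y y' ≤ dist x x' := by
  refine le_of_forall_gt fun c hc => ?_
  obtain ⟨q, hq1, hq2⟩ := exists_rat_btwn hc
  obtain ⟨i, hi⟩ := exists_rationalRadius_eq q
  rw [← hi] at hq1 hq2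
  obtain ⟨n, hn⟩ := exists_mem_traceBall hu x (dist_nonneg.trans_lt hq1)
  have h2 : x' ∈ traceBall u F (n, i, 0) := by
    rw [traceBall_eq_ball (hn 0), Metric.mem_ball, dist_comm]
    exact hq1
  have h3 := hx' _ h2
  rw [traceBall_eq_ball (hx _ (hn 0)), h.radius _ ⟨x, hn 0⟩, Metric.mem_ball, dist_comm] at h3
  exact h3.trans hq2

theorem BallRelated.symm [IsUltrametricDist F] (hu : DenseRange u)
    (h : IsBallEmbedding u F F' σ τ) (h' : IsBallEmbedding u F' F τ σ) {x : F} {y : F'}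
    (hx : BallRelated u F F' σ x y) : BallRelated u F' F τ y x := by
  intro q hq
  have hr := h'.radius q ⟨y, hq⟩
  have hpos : 0 < rationalRadius (τ q).2.1 := by
    rw [hr]
    exact rationalRadius_pos_of_mem hq
  obtain ⟨n, hn⟩ := exists_mem_traceBall hu x hpos
  -- Meeting can be tested in `F'`, where `y` is a common point. Two balls of equal radius that meet
  -- coincide, so `x` lies in the ball named `τ q`.
  have hm : (traceBall u F (n, (τ q).2.1, 0) ∩ traceBall u F (τ q)).Nonempty := by
    rw [h.meet _ _ ⟨x, hn 0⟩ (h'.nonempty _ ⟨y, hq⟩), h'.inv _ ⟨y, hq⟩]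
    exact ⟨y, hx _ (hn 0), hq⟩
  obtain ⟨z, hz1, hz2⟩ := hm
  have := hn 0
  rw [traceBall_eq_ball hz1] at this
  rwa [traceBall_eq_ball hz2]

/-- The balls around `x` of radius `1 / (k + 1)` correspond to balls of `F'` that meet pairwise and
are hence nested. Points chosen in them form a Cauchy sequence, and its limit is the desired point.
-/
theorem exists_ballRelated [IsUltrametricDist F'] [CompleteSpace F'] (hu : DenseRange u)
    (h : IsBallEmbedding u F F' σ τ) (x : F) : ∃ y, BallRelated u F F' σ x y := by
  have hr : ∀ k : ℕ, ∃ i, rationalRadius i = 1 / ((k : ℝ) + 1) := fun k => by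
    obtain ⟨i, hi⟩ := exists_rationalRadius_eq (1 / ((k : ℚ) + 1))
    exact ⟨i, by rw [hi]; push_cast; rfl⟩
  choose c hc using hr
  have hp : ∀ k, ∃ p : ℕ × ℕ × ℕ, p.2.1 = c k ∧ x ∈ traceBall u F p := fun k => by
    obtain ⟨n, hn⟩ := exists_mem_traceBall hu x (i := c k) (by rw [hc]; positivity)
    exact ⟨_, rfl, hn 0⟩
  choose p hp1 hp2 using hp
  have hne : ∀ k, (traceBall u F' (σ (p k))).Nonempty := fun k => h.nonempty _ ⟨x, hp2 k⟩
  have hrad : ∀ k, rationalRadius (σ (p k)).2.1 = 1 / ((k : ℝ) + 1) := fun k => by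
    rw [h.radius _ ⟨x, hp2 k⟩, hp1, hc]
  choose y hy using hne
  have hcl : ∀ q, x ∈ traceBall u F q → ∀ k : ℕ,
      1 / ((k : ℝ) + 1) ≤ rationalRadius q.2.1 → y k ∈ traceBall u F' (σ q) := by
    intro q hq k hk
    obtain ⟨z, hz1, hz2⟩ := (h.meet q (p k) ⟨x, hq⟩ ⟨x, hp2 k⟩).1 ⟨x, hq, hp2 k⟩
    have h1 := hy k
    rw [traceBall_eq_ball hz2, Metric.mem_ball, hrad] at h1
    rw [traceBall_eq_ball hz1, Metric.mem_ball, h.radius _ ⟨x, hq⟩]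
    exact h1.trans_le hk
  have hmono : ∀ k l : ℕ, k ≤ l → y l ∈ Metric.ball (y k) (1 / ((k : ℝ) + 1)) := by
    intro k l hkl
    rw [← hrad k, ← traceBall_eq_ball (hy k)]
    refine hcl _ (hp2 k) l ?_
    rw [hp1, hc]
    exact one_div_le_one_div_of_le (by positivity) (by exact_mod_cast Nat.succ_le_succ hkl)
  have hcauchy : CauchySeq y := by
    refine cauchySeq_of_le_tendsto_0' (fun k : ℕ => 1 / ((k : ℝ) + 1)) (fun k l hkl => ?_)
      tendsto_one_div_add_atTop_nhds_zero_nat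
    have := hmono k l hkl
    rw [Metric.mem_ball, dist_comm] at this
    exact this.le
  obtain ⟨y₀, hy₀⟩ := cauchySeq_tendsto_of_complete hcauchy
  refine ⟨y₀, fun q hq => ?_⟩
  obtain ⟨z, hz⟩ := h.nonempty q ⟨x, hq⟩
  -- Open balls of an ultrametric space are closed, so the limit stays inside.
  have hclosed : IsClosed (traceBall u F' (σ q)) := by
    rw [traceBall_eq_ball hz]
    exact IsUltrametricDist.isClosed_ball _ _
  refine hclosed.mem_of_tendsto hy₀ ?_
  have hq0 := rationalRadius_pos_of_mem hq
  filter_upwards [tendsto_one_div_add_atTop_nhds_zero_nat.eventually_lt_const hq0] with k hk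
  exact hcl q hq k hk.le

theorem IsBallEmbedding.nonempty_isometryEquiv [IsUltrametricDist F] [IsUltrametricDist F']
    [CompleteSpace F] [CompleteSpace F'] (hu : DenseRange u)
    (h : IsBallEmbedding u F F' σ τ) (h' : IsBallEmbedding u F' F τ σ) :
    Nonempty (F ≃ᵢ F') := by
  choose f hf using exists_ballRelated hu h
  choose g hg using exists_ballRelated hu h'
  refine ⟨IsometryEquiv.mk' f g (fun y => ?_) (Isometry.of_dist_eq fun x x' => ?_)⟩
  · have := BallRelated.dist_le hu h (hf (g y)) ((hg y).symm hu h' h)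
    rw [dist_self] at this
    exact dist_le_zero.1 this
  · exact le_antisymm ((hf x).dist_le hu h (hf x'))
      (((hf x).symm hu h h').dist_le hu h' ((hf x').symm hu h h'))

end traceBall

/-- Corresponding fibres are both countably infinite or both empty. This is what the infinitely many
names of each ball are for: names can be matched bijectively however often a ball was named
originally. -/
theorem exists_equiv_comp_eq {P C : Type*} [Countable P] {f g : P → C}
    (hf : ∀ p, {p' | f p' = f p}.Infinite) (hg : ∀ p, {p' | g p' = g p}.Infinite)
    (hr : Set.range f = Set.range g) : ∃ e : P ≃ P, ∀ p, g (e p) = f p := by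
  have key : ∀ c, Nonempty ({p // f p = c} ≃ {p // g p = c}) := by
    intro c
    by_cases hc : c ∈ Set.range f
    · obtain ⟨p, rfl⟩ := hc
      obtain ⟨q, hq⟩ : f p ∈ Set.range g := hr ▸ ⟨p, rfl⟩
      have h1 : Infinite {p' // f p' = f p} := (hf p).to_subtype
      have h2 : Infinite {q' // g q' = f p} := by
        rw [← hq]
        exact (hg q).to_subtype
      exact nonempty_equiv_of_countable
    · have h1 : IsEmpty {p // f p = c} := ⟨fun p => hc ⟨p, p.2⟩⟩
      have h2 : IsEmpty {p // g p = c} := ⟨fun p => hc (hr ▸ ⟨p, p.2⟩)⟩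
      exact ⟨Equiv.equivOfIsEmpty _ _⟩
  let E : ∀ c, {p // f p = c} ≃ {p // g p = c} := fun c => (key c).some
  refine ⟨(Equiv.sigmaFiberEquiv f).symm.trans
    ((Equiv.sigmaCongrRight E).trans (Equiv.sigmaFiberEquiv g)), fun p => ?_⟩
  exact (E (f p) ⟨p, rfl⟩).2

/-! ### The graph of balls -/

section ballGraph

variable {M : Type*} [MetricSpace M]

/-- The intersection graph of the balls of `F`. To a ball of radius `rationalRadius i` there are
attached `i` leaves. -/
def ballGraph (u : ℕ → M) (F : Set M) : SimpleGraph ((ℕ × ℕ × ℕ) × ℕ) where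
  Adj v w := v ≠ w ∧ ((v.2 = 0 ∧ w.2 = 0 ∧ (traceBall u F v.1 ∩ traceBall u F w.1).Nonempty) ∨
    (v.1 = w.1 ∧ (traceBall u F v.1 ∩ traceBall u F w.1).Nonempty ∧
      (v.2 = 0 ∧ w.2 ≤ v.1.2.1 ∨ w.2 = 0 ∧ v.2 ≤ v.1.2.1)))
  symm := by
    constructor
    rintro ⟨p, s⟩ ⟨q, t⟩ ⟨h, h' | h'⟩
    · refine ⟨h.symm, Or.inl ?_⟩
      rw [Set.inter_comm]
      tauto
    · refine ⟨h.symm, Or.inr ?_⟩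
      rw [Set.inter_comm]
      obtain ⟨h1, h2⟩ := h'
      dsimp only at h1
      subst h1
      tauto
  loopless := ⟨fun v h => h.1 rfl⟩

variable {u : ℕ → M} {F F' : Set M}

theorem ballGraph_adj_zero {p q : ℕ × ℕ × ℕ} : (ballGraph u F).Adj (p, 0) (q, 0) ↔
    p ≠ q ∧ (traceBall u F p ∩ traceBall u F q).Nonempty := by
  simp only [ballGraph, ne_eq, Prod.mk.injEq, and_true, true_and]
  tauto

theorem ballGraph_adj_zero_left {p q : ℕ × ℕ × ℕ} {s : ℕ} (hs : s ≠ 0) :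
    (ballGraph u F).Adj (p, 0) (q, s) ↔
      p = q ∧ (traceBall u F p).Nonempty ∧ s ≤ p.2.1 := by
  simp only [ballGraph, ne_eq, Prod.mk.injEq]
  constructor
  · rintro ⟨-, ⟨-, h, -⟩ | ⟨rfl, h, h'⟩⟩
    · exact absurd h hs
    · rw [Set.inter_self] at h
      tauto
  · rintro ⟨rfl, h, h'⟩
    rw [Set.inter_self]
    exact ⟨fun h => hs h.2.symm, Or.inr ⟨rfl, h, Or.inl ⟨trivial, h'⟩⟩⟩

theorem not_ballGraph_adj {p q : ℕ × ℕ × ℕ} {s t : ℕ} (hs : s ≠ 0) (ht : t ≠ 0) :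
    ¬ (ballGraph u F).Adj (p, s) (q, t) := by
  simp only [ballGraph]
  tauto

/-- The name of a nonempty ball is adjacent to all other names of that ball, whereas a leaf has one
neighbour and the remaining vertices none. Infinite degree thus singles out the ball vertices in an
isomorphism-invariant way. -/
theorem infinite_neighborSet_ballGraph_iff [IsUltrametricDist F] {v : (ℕ × ℕ × ℕ) × ℕ} :
    ((ballGraph u F).neighborSet v).Infinite ↔ v.2 = 0 ∧ (traceBall u F v.1).Nonempty := by
  obtain ⟨p, s⟩ := v
  constructor
  · intro h
    rcases eq_or_ne s 0 with rfl | hs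
    · obtain ⟨⟨q, t⟩, hw⟩ := h.nonempty
      rw [SimpleGraph.mem_neighborSet] at hw
      rcases eq_or_ne t 0 with rfl | ht
      · exact ⟨rfl, (ballGraph_adj_zero.1 hw).2.left⟩
      · exact ⟨rfl, ((ballGraph_adj_zero_left ht).1 hw).2.1⟩
    · refine absurd ((Set.finite_singleton (p, 0)).subset ?_) h
      rintro ⟨q, t⟩ hw
      rw [SimpleGraph.mem_neighborSet] at hw
      rcases eq_or_ne t 0 with rfl | ht
      · rw [((ballGraph_adj_zero_left hs).1 hw.symm).1]
        rfl
      · exact absurd hw (not_ballGraph_adj hs ht)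
  · rintro ⟨h0, y, hy⟩
    dsimp only at h0
    subst h0
    have hinj : Function.Injective fun k : ℕ => (((p.1, p.2.1, k), 0) : (ℕ × ℕ × ℕ) × ℕ) := by
      intro k l h
      simpa using h
    refine Set.Infinite.mono ?_ ((Set.infinite_range_of_injective hinj).sdiff
      (Set.finite_singleton (p, 0)))
    rintro _ ⟨⟨k, rfl⟩, hk⟩
    rw [SimpleGraph.mem_neighborSet, ballGraph_adj_zero]
    exact ⟨fun h => hk (by rw [h]; rfl), y, hy, hy⟩

theorem ncard_leaves_ballGraph [IsUltrametricDist F] {p : ℕ × ℕ × ℕ}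
    (hp : (traceBall u F p).Nonempty) :
    {w | (ballGraph u F).Adj (p, 0) w ∧ ¬ ((ballGraph u F).neighborSet w).Infinite}.ncard =
      p.2.1 := by
  have h : {w | (ballGraph u F).Adj (p, 0) w ∧ ¬ ((ballGraph u F).neighborSet w).Infinite} =
      (fun s => (p, s)) '' Set.Icc 1 p.2.1 := by
    ext ⟨q, s⟩
    simp only [Set.mem_ofPred_eq, infinite_neighborSet_ballGraph_iff, Set.mem_image, Set.mem_Icc,
      Prod.mk.injEq]
    constructor
    · rintro ⟨h1, h2⟩
      rcases eq_or_ne s 0 with rfl | hs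
      · exact (h2 ⟨rfl, (ballGraph_adj_zero.1 h1).2.right⟩).elim
      · obtain ⟨h3, -, h4⟩ := (ballGraph_adj_zero_left hs).1 h1
        exact ⟨s, ⟨by omega, h4⟩, h3, rfl⟩
    · rintro ⟨s, ⟨h1, h2⟩, rfl, rfl⟩
      exact ⟨(ballGraph_adj_zero_left (by omega)).2 ⟨rfl, hp, h2⟩, fun h => by omega⟩
  rw [h, Set.ncard_image_of_injective _ (fun s t h => (Prod.mk.inj h).2), Set.ncard_Icc_nat]
  omega

theorem isBallEmbedding_of_iso [IsUltrametricDist F] [IsUltrametricDist F']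
    (e : ballGraph u F ≃g ballGraph u F') :
    IsBallEmbedding u F F' (fun p => (e (p, 0)).1) (fun p => (e.symm (p, 0)).1) := by
  have hinf : ∀ v, ((ballGraph u F').neighborSet (e v)).Infinite ↔
      ((ballGraph u F).neighborSet v).Infinite := fun v => by
    have : (ballGraph u F').neighborSet (e v) = e '' (ballGraph u F).neighborSet v := by
      ext w
      rw [SimpleGraph.mem_neighborSet, Set.mem_image]
      constructor
      · intro h
        refine ⟨e.symm w, ?_, e.apply_symm_apply w⟩
        rw [SimpleGraph.mem_neighborSet, ← e.map_adj_iff, e.apply_symm_apply]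
        exact h
      · rintro ⟨v, hv, rfl⟩
        exact e.map_adj_iff.2 hv
    rw [this, Set.infinite_image_iff e.injective.injOn]
  have hball : ∀ p, (traceBall u F p).Nonempty →
      e (p, 0) = ((e (p, 0)).1, 0) ∧ (traceBall u F' (e (p, 0)).1).Nonempty := fun p hp => by
    have := (infinite_neighborSet_ballGraph_iff).1
      ((hinf (p, 0)).2 (infinite_neighborSet_ballGraph_iff.2 ⟨rfl, hp⟩))
    exact ⟨Prod.ext rfl this.1, this.2⟩
  refine ⟨fun p hp => (hball p hp).2, fun p hp => ?_, fun p hp => ?_, fun p q hp hq => ?_⟩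
  -- The radius index is the number of neighbours of finite degree, which an isomorphism preserves.
  · rw [← ncard_leaves_ballGraph (hball p hp).2, ← (hball p hp).1, ← ncard_leaves_ballGraph hp,
      ← Set.ncard_image_of_injective {w | (ballGraph u F).Adj (p, 0) w ∧
        ¬ ((ballGraph u F).neighborSet w).Infinite} e.injective]
    congr 1
    ext w
    rw [Set.mem_ofPred_eq, Set.mem_image]
    constructor
    · rintro ⟨h1, h2⟩
      refine ⟨e.symm w, ⟨?_, ?_⟩, e.apply_symm_apply w⟩
      · rwa [← e.map_adj_iff, e.apply_symm_apply]
      · rwa [← hinf, e.apply_symm_apply]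
    · rintro ⟨v, ⟨h1, h2⟩, rfl⟩
      exact ⟨e.map_adj_iff.2 h1, by rwa [hinf]⟩
  · rw [← (hball p hp).1, e.symm_apply_apply]
  · rcases eq_or_ne p q with rfl | hpq
    · simp only [Set.inter_self, hp, (hball p hp).2]
    · have h1 : (ballGraph u F').Adj (e (p, 0)) (e (q, 0)) ↔ _ := e.map_adj_iff
      rw [(hball p hp).1, (hball q hq).1, ballGraph_adj_zero, ballGraph_adj_zero] at h1
      have h2 : (e (p, 0)).1 ≠ (e (q, 0)).1 := fun h => by
        have := (hball p hp).1.trans ((congrArg (fun r => (r, 0)) h).trans (hball q hq).1.symm)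
        exact hpq (Prod.mk.inj (e.injective this)).1
      tauto

theorem nonempty_ballGraph_iso_of_isometryEquiv [IsUltrametricDist F] [IsUltrametricDist F']
    (hu : DenseRange u) (φ : F ≃ᵢ F') : Nonempty (ballGraph u F ≃g ballGraph u F') := by
  classical
  -- The colour of a name is its ball together with its radius index, since one set can be a ball of
  -- several radii. All empty names share the colour index `0`, because an index may have empty
  -- names for one space and none for the other.
  let f : ℕ × ℕ × ℕ → ℕ × Set F := fun p =>
    (if (traceBall u F p).Nonempty then p.2.1 + 1 else 0, traceBall u F p)
  let g : ℕ × ℕ × ℕ → ℕ × Set F := fun p =>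
    (if (φ ⁻¹' traceBall u F' p).Nonempty then p.2.1 + 1 else 0, φ ⁻¹' traceBall u F' p)
  -- Radius `0` provides an empty name for every set, so the empty colour occurs on both sides.
  obtain ⟨z, hz⟩ := exists_rationalRadius_eq 0
  have hempty : ∀ (F : Set M) k, traceBall u F (0, z, k) = ∅ := by
    intro F k
    rw [Set.eq_empty_iff_forall_notMem]
    intro y hy
    exact absurd (rationalRadius_pos_of_mem hy) (by simp [hz])
  have hfib : ∀ {C : Type _} (h : ℕ × ℕ × ℕ → C), (∀ n i k l, h (n, i, k) = h (n, i, l)) →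
      ∀ p, {p' | h p' = h p}.Infinite := by
    intro C h hk p
    have hinj : Function.Injective fun k : ℕ => ((p.1, p.2.1, k) : ℕ × ℕ × ℕ) := by
      intro k l h
      simpa using h
    refine (Set.infinite_range_of_injective hinj).mono ?_
    rintro _ ⟨k, rfl⟩
    exact hk _ _ _ _
  have hpre : ∀ y : F, ∀ p q : ℕ × ℕ × ℕ, p.2.1 = q.2.1 → y ∈ traceBall u F p →
      φ y ∈ traceBall u F' q → traceBall u F p = φ ⁻¹' traceBall u F' q := by
    intro y p q hpq hp hq
    rw [traceBall_eq_ball hp, traceBall_eq_ball hq, hpq, φ.preimage_ball, φ.symm_apply_apply]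
  have hr : Set.range f = Set.range g := by
    ext c
    constructor
    · rintro ⟨p, rfl⟩
      by_cases hp : (traceBall u F p).Nonempty
      · obtain ⟨y, hy⟩ := hp
        obtain ⟨n, hn⟩ := exists_mem_traceBall hu (φ y) (rationalRadius_pos_of_mem hy)
        have := hpre y p (n, p.2.1, 0) rfl hy (hn 0)
        exact ⟨(n, p.2.1, 0), by simp only [f, g, this]⟩
      · refine ⟨(0, z, 0), ?_⟩
        rw [Set.not_nonempty_iff_eq_empty] at hp
        simp [f, g, hp, hempty]
    · rintro ⟨p, rfl⟩
      by_cases hp : (φ ⁻¹' traceBall u F' p).Nonempty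
      · obtain ⟨y, hy⟩ := hp
        obtain ⟨n, hn⟩ := exists_mem_traceBall hu y (rationalRadius_pos_of_mem hy)
        have := hpre y (n, p.2.1, 0) p rfl (hn 0) hy
        exact ⟨(n, p.2.1, 0), by simp only [f, g, this]⟩
      · refine ⟨(0, z, 0), ?_⟩
        rw [Set.not_nonempty_iff_eq_empty] at hp
        simp [f, g, hp, hempty]
  obtain ⟨e, he⟩ := exists_equiv_comp_eq (hfib f fun _ _ _ _ => rfl) (hfib g fun _ _ _ _ => rfl) hr
  have he2 : ∀ p, φ ⁻¹' traceBall u F' (e p) = traceBall u F p := fun p =>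
    congrArg Prod.snd (he p)
  have he1 : ∀ p, (traceBall u F p).Nonempty → (e p).2.1 = p.2.1 := fun p hp => by
    have := congrArg Prod.fst (he p)
    simp only [f, g, he2, if_pos hp] at this
    omega
  have hm : ∀ p q, (traceBall u F' (e p) ∩ traceBall u F' (e q)).Nonempty ↔
      (traceBall u F p ∩ traceBall u F q).Nonempty := fun p q => by
    rw [← he2, ← he2, ← Set.preimage_inter, φ.surjective.nonempty_preimage]
  refine ⟨⟨e.prodCongr (Equiv.refl ℕ), ?_⟩⟩
  rintro ⟨p, s⟩ ⟨q, t⟩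
  simp only [ballGraph, Equiv.prodCongr_apply, Prod.map, Equiv.refl_apply, hm, ne_eq,
    Prod.mk.injEq, e.injective.eq_iff]
  by_cases hp : (traceBall u F p).Nonempty
  · rw [he1 p hp]
  · have : ¬ (traceBall u F p ∩ traceBall u F q).Nonempty := fun h => hp h.left
    simp only [this, false_and, and_false]

theorem nonempty_ballGraph_iso_iff [IsUltrametricDist F] [IsUltrametricDist F']
    [CompleteSpace F] [CompleteSpace F'] (hu : DenseRange u) :
    Nonempty (ballGraph u F ≃g ballGraph u F') ↔ Nonempty (F ≃ᵢ F') :=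
  ⟨fun ⟨e⟩ => (isBallEmbedding_of_iso e).nonempty_isometryEquiv hu (isBallEmbedding_of_iso e.symm),
    fun ⟨φ⟩ => nonempty_ballGraph_iso_of_isometryEquiv hu φ⟩

theorem measurableSet_ballGraph_adj [SecondCountableTopology M] (u : ℕ → M)
    (v w : (ℕ × ℕ × ℕ) × ℕ) :
    MeasurableSet {F : NonemptyClosed M | (ballGraph u F.1).Adj v w} := by
  have h : MeasurableSet {F : NonemptyClosed M |
      (traceBall u F.1 v.1 ∩ traceBall u F.1 w.1).Nonempty} := by
    -- The coordinates are the centre for the first name, a common point, and the centre for the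
    -- second name.
    have hW : IsOpen {z : M × M × M |
        (dist z.1 (u v.1.1) < rationalRadius v.1.2.1 / 2 ∧
          dist z.1 z.2.1 < rationalRadius v.1.2.1) ∧
        dist z.2.2 (u w.1.1) < rationalRadius w.1.2.1 / 2 ∧
          dist z.2.2 z.2.1 < rationalRadius w.1.2.1} := by
      refine IsOpen.inter (IsOpen.inter ?_ ?_) (IsOpen.inter ?_ ?_) <;>
        exact isOpen_lt (Continuous.dist (by fun_prop) (by fun_prop)) continuous_const
    convert NonemptyClosed.measurableSet_exists_prod_mem hW using 1
    ext F
    constructor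
    · rintro ⟨y, ⟨x, hx⟩, ⟨z, hz⟩⟩
      exact ⟨x, x.2, y, y.2, z, z.2, hx, hz⟩
    · rintro ⟨x, hx, y, hy, z, hz, h1, h2⟩
      exact ⟨⟨y, hy⟩, ⟨⟨x, hx⟩, h1⟩, ⟨⟨z, hz⟩, h2⟩⟩
  exact (MeasurableSet.const _).inter ((((MeasurableSet.const _).inter
    ((MeasurableSet.const _).inter h))).union ((MeasurableSet.const _).inter
      (h.inter (MeasurableSet.const _))))

end ballGraph

/-- Isometry on any class of ultrametric Polish spaces is reducible to graph isomorphism. -/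
theorem borelReducible_isometric_graphIso {C : NonemptyClosed UrysohnSpace → Prop}
    (hC : ∀ F, C F → IsUltrametricDist F.1) :
    BorelReducible (fun X Y : {F // C F} => Isometric X.1 Y.1) GraphIso := by
  let E : (ℕ × ℕ × ℕ) × ℕ ≃ ℕ := Denumerable.eqv _
  refine ⟨fun X => (ballGraph UrysohnSpace.pt X.1.1).comap E.symm, ?_, fun X Y => ?_⟩
  · rw [SimpleGraph.measurable_iff_adj]
    intro v w
    exact (measurableSet_setOfPred.1 (measurableSet_ballGraph_adj UrysohnSpace.pt (E.symm v)
      (E.symm w))).comp measurable_subtype_coe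
  · have h1 := hC X.1 X.2
    have h2 := hC Y.1 Y.2
    have h3 : CompleteSpace X.1.1 := X.1.2.1.completeSpace_coe
    have h4 : CompleteSpace Y.1.1 := Y.1.2.1.completeSpace_coe
    refine (nonempty_ballGraph_iso_iff UrysohnSpace.denseRange_pt).symm.trans ?_
    have e : ∀ F, (ballGraph UrysohnSpace.pt F).comap E.symm ≃g ballGraph UrysohnSpace.pt F :=
      fun F => SimpleGraph.Iso.comap E.symm _
    exact ⟨fun ⟨f⟩ => ⟨(e _).trans (f.trans (e _).symm)⟩,
      fun ⟨f⟩ => ⟨(e _).symm.trans (f.trans (e _))⟩⟩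

/-! ### Isometric copies of countable pseudometric spaces in the Urysohn space -/

open Classical in
/-- A point of the Urysohn space with distances `f` to the points `a`, if there is one. -/
noncomputable def urysohnExt (n : ℕ) (a : Fin n → UrysohnSpace) (f : Fin n → ℝ) : UrysohnSpace :=
  if h : ∃ x, ∀ s, dist x (a s) = f s then h.choose else UrysohnSpace.pt 0

theorem dist_urysohnExt {n : ℕ} {a : Fin n → UrysohnSpace} {f : Fin n → ℝ}
    (h1 : ∀ s t, f s - f t ≤ dist (a s) (a t)) (h2 : ∀ s t, dist (a s) (a t) ≤ f s + f t)
    (s : Fin n) : dist (urysohnExt n a f) (a s) = f s := by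
  have : Nonempty (Fin n) := ⟨s⟩
  have h := UrysohnSpace.exists_exact a f h1 h2
  rw [urysohnExt, dif_pos h]
  exact h.choose_spec s

/-- A sequence in the Urysohn space realizing the pseudometric `δ` on `ℕ`. -/
noncomputable def urysohnSeq (δ : ℕ → ℕ → ℝ) : ℕ → UrysohnSpace
  | n => urysohnExt n (fun i => urysohnSeq δ i) (fun i => δ n i)
decreasing_by exact i.2

/-- By induction, the triangle inequality for `δ` makes the prescribed distances from the new point
a Katetov function on the earlier ones, so the extension property applies. -/
theorem dist_urysohnSeq {δ : ℕ → ℕ → ℝ} (h0 : ∀ i, δ i i = 0) (hc : ∀ i j, δ i j = δ j i)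
    (ht : ∀ i j k, δ i k ≤ δ i j + δ j k) (i j : ℕ) :
    dist (urysohnSeq δ i) (urysohnSeq δ j) = δ i j := by
  have key : ∀ n, ∀ i < n, ∀ j < n, dist (urysohnSeq δ i) (urysohnSeq δ j) = δ i j := by
    intro n
    induction n with
    | zero => intro i hi; omega
    | succ n ih =>
      have hn : ∀ i < n, dist (urysohnSeq δ n) (urysohnSeq δ i) = δ n i := by
        intro i hi
        conv_lhs => enter [1]; unfold urysohnSeq
        refine dist_urysohnExt (a := fun i : Fin n => urysohnSeq δ i)
          (f := fun i : Fin n => δ n i) (fun s t => ?_) (fun s t => ?_) ⟨i, hi⟩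
        · rw [ih s s.2 t t.2, hc s t]
          linarith [ht n t s]
        · rw [ih s s.2 t t.2, hc n s]
          exact ht s n t
      intro i hi j hj
      rcases Nat.lt_succ_iff_lt_or_eq.1 hi with hi' | rfl
      · rcases Nat.lt_succ_iff_lt_or_eq.1 hj with hj' | rfl
        · exact ih i hi' j hj'
        · rw [dist_comm, hn i hi', hc]
      · rcases Nat.lt_succ_iff_lt_or_eq.1 hj with hj' | rfl
        · exact hn j hj'
        · rw [dist_self, h0]
  exact key (max i j + 1) i (by omega) j (by omega)

/-- This locality of the recursion makes any regularity of the choice in `urysohnExt` irrelevant for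
measurability. -/
theorem urysohnSeq_congr {δ δ' : ℕ → ℕ → ℝ} {n : ℕ}
    (h : ∀ i ≤ n, ∀ j ≤ n, δ i j = δ' i j) : urysohnSeq δ n = urysohnSeq δ' n := by
  induction n using Nat.strong_induction_on with
  | _ n ih =>
    unfold urysohnSeq
    dsimp only
    congr 1
    · funext i
      exact ih i i.2 fun a ha b hb => h a (by omega) b (by omega)
    · funext i
      exact h n le_rfl i i.2.le

/-- This trades isometries of the subspaces for maps of index sets that are inverse up to points
being identified. -/
theorem nonempty_range_isometryEquiv_iff {P Q M N : Type*} [MetricSpace M] [MetricSpace N]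
    (x : P → M) (y : Q → N) :
    Nonempty (Set.range x ≃ᵢ Set.range y) ↔ ∃ (a : P → Q) (b : Q → P),
      (∀ p p', dist (y (a p)) (y (a p')) = dist (x p) (x p')) ∧
      (∀ p, x (b (a p)) = x p) ∧ ∀ q, y (a (b q)) = y q := by
  constructor
  · rintro ⟨φ⟩
    have ha : ∀ p, ∃ q, y q = φ ⟨x p, p, rfl⟩ := fun p => (φ ⟨x p, p, rfl⟩).2
    have hb : ∀ q, ∃ p, x p = φ.symm ⟨y q, q, rfl⟩ := fun q => (φ.symm ⟨y q, q, rfl⟩).2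
    choose a ha using ha
    choose b hb using hb
    refine ⟨a, b, fun p p' => ?_, fun p => ?_, fun q => ?_⟩
    · rw [ha, ha, ← Subtype.dist_eq, φ.dist_eq, Subtype.dist_eq]
    · rw [hb]
      have : (⟨y (a p), a p, rfl⟩ : Set.range y) = φ ⟨x p, p, rfl⟩ := Subtype.ext (ha p)
      rw [this, φ.symm_apply_apply]
    · rw [ha]
      have : (⟨x (b q), b q, rfl⟩ : Set.range x) = φ.symm ⟨y q, q, rfl⟩ := Subtype.ext (hb q)
      rw [this, φ.apply_symm_apply]
  · rintro ⟨a, b, hd, hab, hba⟩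
    have hc : ∀ p p', x p = x p' ↔ y (a p) = y (a p') := fun p p' => by
      rw [← dist_eq_zero, ← hd, dist_eq_zero]
    let f : Set.range x → Set.range y := fun u => ⟨y (a u.2.choose), _, rfl⟩
    let g : Set.range y → Set.range x := fun v => ⟨x (b v.2.choose), _, rfl⟩
    have hf : ∀ p, f ⟨x p, p, rfl⟩ = ⟨y (a p), a p, rfl⟩ := fun p =>
      Subtype.ext ((hc _ _).1 (Exists.choose_spec (⟨p, rfl⟩ : x p ∈ Set.range x)))
    have hg : ∀ q, g ⟨y q, q, rfl⟩ = ⟨x (b q), b q, rfl⟩ := fun q => by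
      refine Subtype.ext ((hc _ _).2 ?_)
      rw [hba, hba]
      exact Exists.choose_spec (⟨q, rfl⟩ : y q ∈ Set.range y)
    refine ⟨IsometryEquiv.mk' f g ?_ (Isometry.of_dist_eq ?_)⟩
    · rintro ⟨_, q, rfl⟩
      rw [hg, hf]
      exact Subtype.ext (hba q)
    · rintro ⟨_, p, rfl⟩ ⟨_, p', rfl⟩
      rw [hf, hf]
      exact hd p p'

/-! ### Ultrametrics on weighted trees of finite sequences -/

/-- The length of the longest common prefix. -/
def List.lcpLength : List ℕ → List ℕ → ℕ
  | a :: s, b :: t => if a = b then lcpLength s t + 1 else 0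
  | _, _ => 0

namespace List

theorem le_lcpLength_iff {s t : List ℕ} {k : ℕ} :
    k ≤ lcpLength s t ↔ k ≤ s.length ∧ k ≤ t.length ∧ s.take k = t.take k := by
  induction s generalizing t k with
  | nil => cases k <;> simp [lcpLength]
  | cons a s ih =>
    cases t with
    | nil => cases k <;> simp [lcpLength]
    | cons b t =>
      cases k with
      | zero => simp
      | succ k =>
        by_cases h : a = b <;> simp [lcpLength, h, ih]

theorem lcpLength_comm (s t : List ℕ) : lcpLength s t = lcpLength t s :=
  eq_of_forall_le_iff fun k => by
    rw [le_lcpLength_iff, le_lcpLength_iff]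
    tauto

theorem lcpLength_self (s : List ℕ) : lcpLength s s = s.length :=
  eq_of_forall_le_iff fun k => by simp [le_lcpLength_iff]

theorem lcpLength_le_left (s t : List ℕ) : lcpLength s t ≤ s.length :=
  (le_lcpLength_iff.1 le_rfl).1

/-- This is the source of the ultrametric inequality for `treeDist`, as distances decrease with the
common prefix. -/
theorem min_lcpLength_le (s t u : List ℕ) :
    min (lcpLength s t) (lcpLength t u) ≤ lcpLength s u := by
  have h1 := le_lcpLength_iff.1 (min_le_left (lcpLength s t) (lcpLength t u))
  have h2 := le_lcpLength_iff.1 (min_le_right (lcpLength s t) (lcpLength t u))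
  exact le_lcpLength_iff.2 ⟨h1.1, h2.2.1, h1.2.2.trans h2.2.2⟩

theorem length_le_lcpLength_iff {s t : List ℕ} : s.length ≤ lcpLength s t ↔ s <+: t := by
  rw [le_lcpLength_iff, prefix_iff_eq_take, take_length]
  constructor
  · exact fun h => h.2.2
  · intro h
    refine ⟨le_rfl, ?_, h⟩
    have := congrArg length h
    rw [length_take] at this
    omega

end List

/-- The pseudometric on `List ℕ × ℕ` in which the node `s` of the tree of finite sequences carries
`c s + 2` points. -/
noncomputable def treeDist (c : List ℕ → ℕ) (p q : List ℕ × ℕ) : ℝ :=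
  if p.1 = q.1 ∧ min p.2 (c p.1 + 1) = min q.2 (c q.1 + 1) then 0
  else 1 + (2 : ℝ)⁻¹ ^ p.1.lcpLength q.1

section treeDist

variable (c : List ℕ → ℕ)

theorem treeDist_self (p : List ℕ × ℕ) : treeDist c p p = 0 := by
  rw [treeDist, if_pos ⟨rfl, rfl⟩]

theorem treeDist_comm (p q : List ℕ × ℕ) : treeDist c p q = treeDist c q p := by
  rw [treeDist, treeDist, List.lcpLength_comm]
  refine if_congr ?_ rfl rfl
  rw [eq_comm, eq_comm (a := min p.2 _)]

theorem treeDist_nonneg (p q : List ℕ × ℕ) : 0 ≤ treeDist c p q := by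
  rw [treeDist]
  split_ifs <;> positivity

variable {c}

theorem treeDist_eq_zero_iff {p q : List ℕ × ℕ} :
    treeDist c p q = 0 ↔ p.1 = q.1 ∧ min p.2 (c p.1 + 1) = min q.2 (c q.1 + 1) := by
  rw [treeDist]
  split_ifs with h
  · simp only [true_iff]
    exact h
  · refine ⟨fun h' => ?_, fun h' => absurd h' h⟩
    have : (0 : ℝ) < 1 + (2 : ℝ)⁻¹ ^ p.1.lcpLength q.1 := by positivity
    linarith

theorem treeDist_of_ne_zero {p q : List ℕ × ℕ} (h : treeDist c p q ≠ 0) :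
    treeDist c p q = 1 + (2 : ℝ)⁻¹ ^ p.1.lcpLength q.1 := by
  rw [Ne, treeDist_eq_zero_iff] at h
  rw [treeDist, if_neg h]

theorem treeDist_ultra (p q r : List ℕ × ℕ) :
    treeDist c p r ≤ max (treeDist c p q) (treeDist c q r) := by
  by_cases hpq : treeDist c p q = 0
  · have h := treeDist_eq_zero_iff.1 hpq
    refine le_max_of_le_right (le_of_eq ?_)
    rw [treeDist, treeDist, h.2, h.1]
  by_cases hqr : treeDist c q r = 0
  · have h := treeDist_eq_zero_iff.1 hqr
    refine le_max_of_le_left (le_of_eq ?_)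
    rw [treeDist, treeDist, h.2, h.1]
  by_cases hpr : treeDist c p r = 0
  · rw [hpr]
    exact le_max_of_le_left (treeDist_nonneg _ _ _)
  rw [treeDist_of_ne_zero hpq, treeDist_of_ne_zero hqr, treeDist_of_ne_zero hpr, le_max_iff]
  have := List.min_lcpLength_le p.1 q.1 r.1
  rcases min_le_iff.1 this with h | h
  · left
    gcongr 1 + ?_
    exact pow_le_pow_of_le_one (by norm_num) (by norm_num) h
  · right
    gcongr 1 + ?_
    exact pow_le_pow_of_le_one (by norm_num) (by norm_num) h

theorem treeDist_triangle (p q r : List ℕ × ℕ) :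
    treeDist c p r ≤ treeDist c p q + treeDist c q r :=
  (treeDist_ultra p q r).trans
    (max_le_add_of_nonneg (treeDist_nonneg _ _ _) (treeDist_nonneg _ _ _))

/-- Every node carries at least two points, even when its weight is `0`; this is the purpose of the
`2` in `c s + 2`. -/
theorem exists_treeDist_eq (c : List ℕ → ℕ) (p : List ℕ × ℕ) :
    ∃ q : List ℕ × ℕ, q.1 = p.1 ∧ treeDist c p q ≠ 0 := by
  by_cases h : p.2 = 0
  · refine ⟨(p.1, 1), rfl, fun h' => ?_⟩
    have := (treeDist_eq_zero_iff.1 h').2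
    simp [h] at this
  · refine ⟨(p.1, 0), rfl, fun h' => ?_⟩
    have := (treeDist_eq_zero_iff.1 h').2
    simp at this
    omega

variable {c' : List ℕ → ℕ} {a b : List ℕ × ℕ → List ℕ × ℕ}

theorem lcpLength_eq_of_treeDist_eq {p q p' q' : List ℕ × ℕ} (h : treeDist c p q ≠ 0)
    (h' : treeDist c' p' q' = treeDist c p q) :
    p'.1.lcpLength q'.1 = p.1.lcpLength q.1 := by
  have h2 : treeDist c' p' q' ≠ 0 := by rwa [h']
  rw [treeDist_of_ne_zero h, treeDist_of_ne_zero h2] at h'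
  have h3 : (2 : ℝ)⁻¹ ^ p'.1.lcpLength q'.1 = (2 : ℝ)⁻¹ ^ p.1.lcpLength q.1 := by linarith
  exact pow_right_injective₀ (by norm_num) (by norm_num) h3

/-- The length of a node is the common prefix length of two distinct points at it. Distances
preserve this number, and it cannot exceed the length of the image node. -/
theorem length_le_of_treeDist_eq
    (hd : ∀ p q, treeDist c' (a p) (a q) = treeDist c p q) (p : List ℕ × ℕ) :
    p.1.length ≤ (a p).1.length := by
  obtain ⟨q, hq, hpq⟩ := exists_treeDist_eq c p
  have := lcpLength_eq_of_treeDist_eq hpq (hd p q)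
  rw [hq, List.lcpLength_self] at this
  rw [← this]
  exact List.lcpLength_le_left _ _

/-- An isometry between the spaces of two weighted trees is induced by an isomorphism of the
weighted trees. -/
theorem exists_treeIso_of_treeDist_eq
    (hd : ∀ p q, treeDist c' (a p) (a q) = treeDist c p q)
    (hba : ∀ p, treeDist c (b (a p)) p = 0) (hab : ∀ q, treeDist c' (a (b q)) q = 0) :
    ∃ f g : List ℕ → List ℕ, (∀ t, f (g t) = t) ∧ (∀ s, g (f s) = s) ∧
      (∀ s, (f s).length = s.length) ∧ (∀ s t, s <+: t → f s <+: f t) ∧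
      (∀ s t, s <+: t → g s <+: g t) ∧ ∀ s, c' (f s) = c s := by
  have hd0 : ∀ {c : List ℕ → ℕ} {p p' q q' : List ℕ × ℕ}, treeDist c p' p = 0 →
      treeDist c q' q = 0 → treeDist c p' q' = treeDist c p q := by
    intro c p p' q q' hp hq
    have hp' := hp
    have hq' := hq
    rw [treeDist_comm] at hp' hq'
    refine le_antisymm ?_ ?_
    · linarith [treeDist_triangle (c := c) p' p q', treeDist_triangle (c := c) p q q']
    · linarith [treeDist_triangle (c := c) p p' q, treeDist_triangle (c := c) p' q' q]
  have hdb : ∀ p q, treeDist c (b p) (b q) = treeDist c' p q := fun p q => by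
    rw [← hd, hd0 (hab p) (hab q)]
  -- the situation is symmetric, so both inequalities follow from one
  have len : ∀ {c c' : List ℕ → ℕ} {a b : List ℕ × ℕ → List ℕ × ℕ},
      (∀ p q, treeDist c' (a p) (a q) = treeDist c p q) →
      (∀ p q, treeDist c (b p) (b q) = treeDist c' p q) →
      (∀ p, treeDist c (b (a p)) p = 0) → ∀ p, (a p).1.length = p.1.length := by
    intro c c' a b hd hdb hba p
    refine le_antisymm ?_ (length_le_of_treeDist_eq hd p)
    have := length_le_of_treeDist_eq hdb (a p)
    rwa [(treeDist_eq_zero_iff.1 (hba p)).1] at this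
  have lcp : ∀ {c c' : List ℕ → ℕ} {a b : List ℕ × ℕ → List ℕ × ℕ},
      (∀ p q, treeDist c' (a p) (a q) = treeDist c p q) →
      (∀ p q, treeDist c (b p) (b q) = treeDist c' p q) →
      (∀ p, treeDist c (b (a p)) p = 0) →
      ∀ p q, (a p).1.lcpLength (a q).1 = p.1.lcpLength q.1 := by
    intro c c' a b hd hdb hba p q
    by_cases h : treeDist c p q = 0
    · have h1 := (treeDist_eq_zero_iff.1 h).1
      have h2 := (treeDist_eq_zero_iff.1 ((hd p q).trans h)).1
      rw [← h2, ← h1, List.lcpLength_self, List.lcpLength_self, len hd hdb hba]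
    · exact lcpLength_eq_of_treeDist_eq h (hd p q)
  have node : ∀ {c c' : List ℕ → ℕ} {a b : List ℕ × ℕ → List ℕ × ℕ},
      (∀ p q, treeDist c' (a p) (a q) = treeDist c p q) →
      (∀ p q, treeDist c (b p) (b q) = treeDist c' p q) →
      (∀ p, treeDist c (b (a p)) p = 0) →
      ∀ p q, p.1 <+: q.1 → (a p).1 <+: (a q).1 := by
    intro c c' a b hd hdb hba p q h
    rw [← List.length_le_lcpLength_iff] at h ⊢
    rwa [lcp hd hdb hba, len hd hdb hba]
  have node_eq : ∀ {c c' : List ℕ → ℕ} {a b : List ℕ × ℕ → List ℕ × ℕ},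
      (∀ p q, treeDist c' (a p) (a q) = treeDist c p q) →
      (∀ p q, treeDist c (b p) (b q) = treeDist c' p q) →
      (∀ p, treeDist c (b (a p)) p = 0) →
      ∀ p q, p.1 = q.1 → (a p).1 = (a q).1 := by
    intro c c' a b hd hdb hba p q h
    refine (node hd hdb hba p q (by rw [h])).eq_of_length ?_
    rw [len hd hdb hba, len hd hdb hba, h]
  have weight : ∀ {c c' : List ℕ → ℕ} {a b : List ℕ × ℕ → List ℕ × ℕ},
      (∀ p q, treeDist c' (a p) (a q) = treeDist c p q) →
      (∀ p q, treeDist c (b p) (b q) = treeDist c' p q) →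
      (∀ p, treeDist c (b (a p)) p = 0) →
      ∀ s, c s ≤ c' (a (s, 0)).1 := by
    intro c c' a b hd hdb hba s
    have hs : ∀ i, (a (s, i)).1 = (a (s, 0)).1 := fun i => node_eq hd hdb hba _ _ rfl
    -- The `c s + 2` distinct points at `s` go to distinct points at one node, so counting compares
    -- the weights. The truncation by `min` picks canonical representatives.
    let F : Fin (c s + 2) → Fin (c' (a (s, 0)).1 + 2) := fun i =>
      ⟨min (a (s, i)).2 (c' (a (s, 0)).1 + 1), by omega⟩
    have hF : Function.Injective F := by
      intro i j hij
      have h1 : treeDist c' (a (s, i)) (a (s, j)) = 0 := by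
        rw [treeDist_eq_zero_iff, hs i, hs j]
        exact ⟨rfl, congrArg Fin.val hij⟩
      rw [hd, treeDist_eq_zero_iff] at h1
      have := h1.2
      simp only at this
      have := i.2
      have := j.2
      ext
      omega
    have := Fintype.card_le_of_injective F hF
    simp only [Fintype.card_fin] at this
    omega
  refine ⟨fun s => (a (s, 0)).1, fun t => (b (t, 0)).1, fun t => ?_, fun s => ?_, fun s => ?_,
    fun s t h => ?_, fun s t h => ?_, fun s => ?_⟩
  · exact (node_eq hd hdb hba ((b (t, 0)).1, 0) (b (t, 0)) rfl).trans
      (treeDist_eq_zero_iff.1 (hab (t, 0))).1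
  · exact (node_eq hdb hd hab ((a (s, 0)).1, 0) (a (s, 0)) rfl).trans
      (treeDist_eq_zero_iff.1 (hba (s, 0))).1
  · exact len hd hdb hba _
  · exact node hd hdb hba _ _ h
  · exact node hdb hd hab _ _ h
  · refine le_antisymm ?_ (weight hd hdb hba s)
    refine (weight hdb hd hab (a (s, 0)).1).trans (le_of_eq ?_)
    rw [node_eq hdb hd hab ((a (s, 0)).1, 0) (a (s, 0)) rfl]
    exact congrArg c (treeDist_eq_zero_iff.1 (hba (s, 0))).1

end treeDist

/-! ### From graphs to weighted trees -/

open Classical in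
/-- The atomic type of a pair of vertices. -/
noncomputable def SimpleGraph.pairType (G : SimpleGraph ℕ) (v w : ℕ) : ℕ :=
  if v = w then 0 else if G.Adj v w then 1 else 2

/-- A code for the atomic type of a finite sequence of vertices. -/
noncomputable def SimpleGraph.typeCode (G : SimpleGraph ℕ) (s : List ℕ) : ℕ :=
  Encodable.encode (s.map fun v => s.map (G.pairType v))

namespace SimpleGraph

variable {G H : SimpleGraph ℕ}

/-- Recording equality besides adjacency later makes the back-and-forth relation a bijection. -/
theorem pairType_eq_iff {v w v' w' : ℕ} : G.pairType v w = H.pairType v' w' ↔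
    (v = w ↔ v' = w') ∧ (G.Adj v w ↔ H.Adj v' w') := by
  have h1 : v = w → ¬ G.Adj v w := fun h => by rw [h]; exact G.irrefl
  have h2 : v' = w' → ¬ H.Adj v' w' := fun h => by rw [h]; exact H.irrefl
  unfold pairType
  split_ifs <;> simp <;> tauto

theorem typeCode_map (e : G ≃g H) (s : List ℕ) : H.typeCode (s.map e) = G.typeCode s := by
  unfold typeCode
  congr 1
  rw [List.map_map]
  refine List.map_congr_left fun v _ => ?_
  simp only [Function.comp, List.map_map]
  refine List.map_congr_left fun w _ => ?_
  exact pairType_eq_iff.2 ⟨e.injective.eq_iff, e.map_rel_iff⟩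

theorem typeCode_congr {s : List ℕ} (h : ∀ v ∈ s, ∀ w ∈ s, G.Adj v w ↔ H.Adj v w) :
    G.typeCode s = H.typeCode s := by
  unfold typeCode
  congr 1
  refine List.map_congr_left fun v hv => List.map_congr_left fun w hw => ?_
  exact pairType_eq_iff.2 ⟨Iff.rfl, h v hv w hw⟩

theorem pairType_eq_of_typeCode_eq {s t : List ℕ} (h : G.typeCode s = H.typeCode t)
    {i j v w v' w' : ℕ} (hv : s[i]? = some v) (hw : s[j]? = some w)
    (hv' : t[i]? = some v') (hw' : t[j]? = some w') : G.pairType v w = H.pairType v' w' := by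
  have h1 := Encodable.encode_injective h
  have h2 := congrArg (fun l : List (List ℕ) => l[i]?) h1
  simp only [List.getElem?_map, hv, hv', Option.map_some, Option.some.injEq] at h2
  have h3 := congrArg (fun l : List ℕ => l[j]?) h2
  simpa only [List.getElem?_map, hw, hw', Option.map_some, Option.some.injEq] using h3

/-- Back-and-forth along an isomorphism of the trees of finite sequences weighted by atomic
types. -/
theorem graphIso_of_treeIso {f g : List ℕ → List ℕ} (hfg : ∀ t, f (g t) = t)
    (hgf : ∀ s, g (f s) = s) (hl : ∀ s, (f s).length = s.length) (hf : ∀ s t, s <+: t → f s <+: f t)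
    (hg : ∀ s t, s <+: t → g s <+: g t)
    (hc : ∀ s, H.typeCode (f s) = G.typeCode s) : GraphIso G H := by
  -- Stage `k` appends `k` on the side of `G`, passes to `H` by `f`, appends `k` there and returns
  -- by `g`. Both `S` and its image under `f` are increasing chains in which every vertex occurs.
  let S : ℕ → List ℕ := fun n => Nat.rec [] (fun k s => g (f (s ++ [k]) ++ [k])) n
  have hS1 : ∀ k, S k ++ [k] <+: S (k + 1) := fun k => by
    conv_lhs => rw [← hgf (S k ++ [k])]
    exact hg _ _ (List.prefix_append _ _)
  have hS2 : ∀ k, f (S (k + 1)) = f (S k ++ [k]) ++ [k] := fun k => hfg _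
  have hmono : ∀ {k l}, k ≤ l → S k <+: S l := by
    intro k l h
    induction h with
    | refl => exact List.prefix_rfl
    | step _ ih => exact ih.trans ((List.prefix_append _ _).trans (hS1 _))
  -- Vertices are matched when they occupy the same position in `S k` and in its image; equality of
  -- atomic types makes this a partial isomorphism.
  let R : ℕ → ℕ → Prop := fun v w => ∃ k i : ℕ, (S k)[i]? = some v ∧ (f (S k))[i]? = some w
  have get_prefix : ∀ {s t : List ℕ} {i v : ℕ}, s <+: t → s[i]? = some v → t[i]? = some v := by
    rintro s _ i v ⟨r, rfl⟩ h
    rw [List.getElem?_append_left]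
    · exact h
    · exact (List.getElem?_eq_some_iff.1 h).1
  have hR : ∀ v w v' w', R v w → R v' w' → (v = v' ↔ w = w') ∧ (G.Adj v v' ↔ H.Adj w w') := by
    rintro v w v' w' ⟨k, i, h1, h2⟩ ⟨l, j, h3, h4⟩
    have hk := hmono (le_max_left k l)
    have hl := hmono (le_max_right k l)
    exact pairType_eq_iff.1 (pairType_eq_of_typeCode_eq (hc (S (max k l))).symm
      (get_prefix hk h1) (get_prefix hl h3) (get_prefix (hf _ _ hk) h2)
      (get_prefix (hf _ _ hl) h4))
  have hR1 : ∀ v, ∃ w, R v w := by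
    intro v
    have h1 : (S v ++ [v])[(S v).length]? = some v := by simp
    have h2 := get_prefix (hS1 v) h1
    have h3 : (S v).length < (f (S (v + 1))).length := by
      rw [hl]
      exact (List.getElem?_eq_some_iff.1 h2).1
    exact ⟨_, v + 1, _, h2, List.getElem?_eq_getElem h3⟩
  have hR2 : ∀ w, ∃ v, R v w := by
    intro w
    have h1 : (f (S (w + 1)))[(f (S w ++ [w])).length]? = some w := by
      rw [hS2]
      simp
    have h3 : (f (S w ++ [w])).length < (S (w + 1)).length := by
      rw [← hl (S (w + 1))]
      exact (List.getElem?_eq_some_iff.1 h1).1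
    exact ⟨_, w + 1, _, List.getElem?_eq_getElem h3, h1⟩
  choose F hF using hR1
  choose K hK using hR2
  exact ⟨{
    toFun := F
    invFun := K
    left_inv := fun v => (hR _ _ _ _ (hK (F v)) (hF v)).1.2 rfl
    right_inv := fun w => (hR _ _ _ _ (hF (K w)) (hK w)).1.1 rfl
    map_rel_iff' := fun {v w} => (hR _ _ _ _ (hF v) (hF w)).2.symm }⟩

/-- Graph isomorphism is the isometry of the associated pseudometric spaces. -/
theorem graphIso_iff_exists_treeDist_eq : GraphIso G H ↔
    ∃ a b : List ℕ × ℕ → List ℕ × ℕ,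
      (∀ p q, treeDist H.typeCode (a p) (a q) = treeDist G.typeCode p q) ∧
      (∀ p, treeDist G.typeCode (b (a p)) p = 0) ∧
      ∀ q, treeDist H.typeCode (a (b q)) q = 0 := by
  constructor
  · rintro ⟨e⟩
    refine ⟨fun p => (p.1.map e, p.2), fun p => (p.1.map e.symm, p.2), fun p q => ?_,
      fun p => ?_, fun q => ?_⟩
    · have hi : Function.Injective (List.map e) := List.map_injective_iff.2 e.injective
      have hl : (p.1.map e).lcpLength (q.1.map e) = p.1.lcpLength q.1 :=
        eq_of_forall_le_iff fun k => by
          simp only [List.le_lcpLength_iff, List.length_map, ← List.map_take, hi.eq_iff]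
      simp only [treeDist, typeCode_map, hl, hi.eq_iff]
    · rw [treeDist_eq_zero_iff]
      simp [Function.comp_def]
    · rw [treeDist_eq_zero_iff]
      simp [Function.comp_def]
  · rintro ⟨a, b, hd, hba, hab⟩
    obtain ⟨f, g, hfg, hgf, hl, hf, hg, hc⟩ := exists_treeIso_of_treeDist_eq hd hba hab
    exact graphIso_of_treeIso hfg hgf hl hf hg hc

/-- A dense sequence in the ultrametric space attached to a graph. -/
noncomputable def urysohnPoint (G : SimpleGraph ℕ) : ℕ → UrysohnSpace :=
  urysohnSeq fun i j =>
    treeDist G.typeCode (Denumerable.ofNat (List ℕ × ℕ) i) (Denumerable.ofNat (List ℕ × ℕ) j)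

theorem dist_urysohnPoint (G : SimpleGraph ℕ) (i j : ℕ) :
    Dist.dist (G.urysohnPoint i) (G.urysohnPoint j) =
      treeDist G.typeCode (Denumerable.ofNat _ i) (Denumerable.ofNat _ j) :=
  dist_urysohnSeq (δ := fun i j => treeDist G.typeCode (Denumerable.ofNat _ i)
    (Denumerable.ofNat _ j)) (fun _ => treeDist_self _ _) (fun _ _ => treeDist_comm _ _ _)
    (fun _ _ _ => treeDist_triangle _ _ _) i j

/-- The ultrametric space attached to a graph. -/
noncomputable def urysohnSpace (G : SimpleGraph ℕ) : NonemptyClosed UrysohnSpace :=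
  ⟨Set.range G.urysohnPoint, by
    -- Distinct points are at least `1` apart, so the countable set is already closed and no closure
    -- has to be taken.
    refine Metric.isClosed_of_pairwise_le_dist one_pos ?_
    rintro _ ⟨i, rfl⟩ _ ⟨j, rfl⟩ h
    rw [← dist_ne_zero, dist_urysohnPoint] at h
    rw [dist_urysohnPoint, treeDist_of_ne_zero h]
    simp, Set.range_nonempty _⟩

theorem isUltrametricDist_urysohnSpace (G : SimpleGraph ℕ) :
    IsUltrametricDist G.urysohnSpace.1 := by
  refine ⟨?_⟩
  rintro ⟨_, i, rfl⟩ ⟨_, j, rfl⟩ ⟨_, k, rfl⟩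
  simp only [Subtype.dist_eq, dist_urysohnPoint]
  exact treeDist_ultra _ _ _

theorem dist_urysohnSpace_mem (G : SimpleGraph ℕ) (x y : G.urysohnSpace.1) :
    Dist.dist x y ∈ ({0} ∪ Set.range fun n : ℕ => 1 + (2 : ℝ)⁻¹ ^ n : Set ℝ) := by
  obtain ⟨_, i, rfl⟩ := x
  obtain ⟨_, j, rfl⟩ := y
  simp only [Subtype.dist_eq, dist_urysohnPoint]
  by_cases h : treeDist G.typeCode (Denumerable.ofNat _ i) (Denumerable.ofNat _ j) = 0
  · exact Or.inl h
  · exact Or.inr ⟨_, (treeDist_of_ne_zero h).symm⟩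

theorem graphIso_iff_isometric : GraphIso G H ↔ Isometric G.urysohnSpace H.urysohnSpace := by
  rw [graphIso_iff_exists_treeDist_eq]
  refine Iff.trans ?_ (nonempty_range_isometryEquiv_iff G.urysohnPoint H.urysohnPoint).symm
  have key : ∀ {G : SimpleGraph ℕ} {i j : ℕ}, G.urysohnPoint i = G.urysohnPoint j ↔
      treeDist G.typeCode (Denumerable.ofNat _ i) (Denumerable.ofNat _ j) = 0 := by
    intro G i j
    rw [← dist_eq_zero, dist_urysohnPoint]
  simp only [key, dist_urysohnPoint]
  constructor
  · rintro ⟨a, b, hd, hba, hab⟩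
    refine ⟨fun i => Encodable.encode (a (Denumerable.ofNat _ i)),
      fun i => Encodable.encode (b (Denumerable.ofNat _ i)), ?_, ?_, ?_⟩
    · intro i j
      simp only [Denumerable.ofNat_encode, hd]
    · intro i
      simp only [Denumerable.ofNat_encode, hba]
    · intro i
      simp only [Denumerable.ofNat_encode, hab]
  · rintro ⟨a, b, hd, hba, hab⟩
    refine ⟨fun p => Denumerable.ofNat _ (a (Encodable.encode p)),
      fun p => Denumerable.ofNat _ (b (Encodable.encode p)), ?_, ?_, ?_⟩
    · intro p q
      simp only [hd, Denumerable.ofNat_encode]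
    · intro p
      simpa only [Denumerable.ofNat_encode, Denumerable.encode_ofNat] using
        hba (Encodable.encode p)
    · intro p
      simpa only [Denumerable.ofNat_encode, Denumerable.encode_ofNat] using
        hab (Encodable.encode p)

/-! ### Measurability of the map from graphs to spaces -/

/-- The map factors through the finite set of adjacency patterns on `N` vertices, where every subset
is measurable; hence `S` may be arbitrary. -/
theorem measurableSet_preimage_of_finite_dependence {β : Type*} {f : SimpleGraph ℕ → β} (N : ℕ)
    (hf : ∀ G H : SimpleGraph ℕ, (∀ i < N, ∀ j < N, G.Adj i j ↔ H.Adj i j) → f G = f H)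
    (S : Set β) : MeasurableSet (f ⁻¹' S) := by
  let M : SimpleGraph ℕ → Fin N → Fin N → Prop := fun G i j => G.Adj i j
  have hM : Measurable M := by
    refine measurable_pi_lambda _ fun i => measurable_pi_lambda _ fun j => ?_
    exact (measurable_pi_apply (j : ℕ)).comp ((measurable_pi_apply (i : ℕ)).comp measurable_adj)
  have h : f ⁻¹' S = M ⁻¹' (M '' (f ⁻¹' S)) := by
    refine (Set.subset_preimage_image _ _).antisymm ?_
    rintro G ⟨H, hH, hHG⟩
    have : f G = f H := hf G H fun i hi j hj => by
      have := congrFun (congrFun hHG ⟨i, hi⟩) ⟨j, hj⟩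
      exact (iff_of_eq this).symm
    rw [Set.mem_preimage, this]
    exact hH
  rw [h]
  exact hM (Set.toFinite _).measurableSet

theorem measurable_urysohnSpace : Measurable urysohnSpace := by
  refine measurable_generateFrom ?_
  rintro _ ⟨U, -, rfl⟩
  have h : urysohnSpace ⁻¹' {F | (F.1 ∩ U).Nonempty} =
      ⋃ n, (fun G : SimpleGraph ℕ => G.urysohnPoint n) ⁻¹' U := by
    ext G
    simp only [Set.mem_preimage, Set.mem_ofPred_eq, Set.mem_iUnion]
    constructor
    · rintro ⟨_, ⟨n, rfl⟩, h⟩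
      exact ⟨n, h⟩
    · rintro ⟨n, h⟩
      exact ⟨_, ⟨n, rfl⟩, h⟩
  rw [h]
  refine MeasurableSet.iUnion fun n => ?_
  -- `L` lists all vertices occurring in the first `n + 1` nodes. Its sum is a crude upper bound for
  -- them, so the `n`-th point depends only on adjacency below `L.sum + 1`.
  let L : List ℕ := (List.range (n + 1)).flatMap fun i =>
    (Denumerable.ofNat (List ℕ × ℕ) i).1
  refine measurableSet_preimage_of_finite_dependence (L.sum + 1) (fun G H hGH => ?_) U
  have hc : ∀ i ≤ n, G.typeCode (Denumerable.ofNat (List ℕ × ℕ) i).1 =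
      H.typeCode (Denumerable.ofNat (List ℕ × ℕ) i).1 := by
    intro i hi
    have hL : ∀ v ∈ (Denumerable.ofNat (List ℕ × ℕ) i).1, v < L.sum + 1 := fun v hv =>
      Nat.lt_succ_of_le (List.le_sum_of_mem
        (List.mem_flatMap.2 ⟨i, List.mem_range.2 (by omega), hv⟩))
    exact typeCode_congr fun v hv w hw => hGH v (hL v hv) w (hL w hw)
  refine urysohnSeq_congr fun i hi j hj => ?_
  simp only [treeDist, hc i hi, hc j hj]

end SimpleGraph

/-! ### The reduction from graph isomorphism and the conclusion -/

theorem graphIso_borelReducible_isometric {C : NonemptyClosed UrysohnSpace → Prop}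
    (hC : ∀ G : SimpleGraph ℕ, C G.urysohnSpace) :
    BorelReducible GraphIso (fun X Y : {F // C F} => Isometric X.1 Y.1) :=
  ⟨fun G => ⟨G.urysohnSpace, hC G⟩, SimpleGraph.measurable_urysohnSpace.subtype_mk,
    fun _ _ => SimpleGraph.graphIso_iff_isometric⟩

theorem mainTheorem2 :
    BorelBireducible
      (fun X Y : DiscreteUltrametricPolish => Isometric X.1 Y.1) GraphIso ∧
    BorelBireducible
      (fun X Y : LocallyCompactUltrametricPolish => Isometric X.1 Y.1) GraphIso ∧
    BorelBireducible
      (fun X Y : UltrametricPolishWithDistances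
          ({0} ∪ Set.range fun n : ℕ => 1 + (2 : ℝ)⁻¹ ^ n) => Isometric X.1 Y.1)
      GraphIso := by
  have hd : ∀ G : SimpleGraph ℕ, DiscreteTopology G.urysohnSpace.1 := fun G => by
    refine DiscreteTopology.of_forall_le_dist one_pos fun x y hxy => ?_
    rcases G.dist_urysohnSpace_mem x y with h | ⟨n, hn⟩
    · exact absurd (dist_eq_zero.1 h) hxy
    · rw [← hn]
      simp
  refine ⟨⟨borelReducible_isometric_graphIso fun _ h => h.1,
    graphIso_borelReducible_isometric fun G => ⟨G.isUltrametricDist_urysohnSpace, hd G⟩⟩,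
    ⟨borelReducible_isometric_graphIso fun _ h => h.1,
    graphIso_borelReducible_isometric fun G => ⟨G.isUltrametricDist_urysohnSpace, ?_⟩⟩,
    ⟨borelReducible_isometric_graphIso fun _ h => h.1,
    graphIso_borelReducible_isometric fun G =>
      ⟨G.isUltrametricDist_urysohnSpace, G.dist_urysohnSpace_mem⟩⟩⟩
  have := hd G
  infer_instance
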